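/- \textbf{Setting.} Let $(V,E)$ be a finite simple undirected graph whose nodes are linearly ordered; its edges are the channels, written $(u,v)$ with $u<v$. Let $a=(a_{i,j})_{(i,j)\in V\times V}$, $a_{i,j}\ge 0$, be a demand vector and $\mathcal N=\{(i,j): a_{i,j}>0\}$. Each $(i,j)\in\mathcal N$ has a finite set $P_{i,j}=\{p_{i,j,1},p_{i,j,2},\dots\}$ of paths from $i$ to $j$, each of which traverses every channel at most once; let $P$ be the disjoint union of the $P_{i,j}$, $(i,j)\in\mathcal N$. The routing matrix $R\in\{-1,0,1\}^{E\times P}$ has entry $1$ (resp. $-1$) at channel $(u,v)$ and path $p$ if $p$ traverses the channel from $u$ to $v$ (resp. from $v$ to $u$), and $0$ if $p$ does not traverse it. Each $(i,j)\in\mathcal N$ has a utility function $U_{i,j}$ that is concave, nondecreasing and differentiable on $[0,a_{i,j}]$ (one-sided, with finite derivative, at the end points), with $U_{i,j}(0)=0$, and a weight $\eta_{i,j}\geq 0$. For $f\in\mathbb R^P$ put $q_{i,j}=\sum_k f_{i,j,k}$, \[U(f)=\sum_{(i,j)\in\mathcal N}U_{i,j}(q_{i,j}),\qquad H(f)=-\sum_{(i,j)\in\mathcal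 N}\eta_{i,j}\sum_k f_{i,j,k}^2,\] \[A=\{f\in\mathbb R^P: f\ge 0,\ q_{i,j}\le a_{i,j}\ \forall (i,j)\in\mathcal N\}.\] Problem $(\mathbf P)$ is to maximize $U(f)+H(f)$ over the $f\in A$ that satisfy the detailed balance condition $Rf=0$. Let $L(f,\lambda)=U(f)+H(f)-\lambda^{T}Rf$ and $D(\lambda)=\max_{f\in A}L(f,\lambda)$ for $\lambda\in\mathbb R^E$. The dual-gradient iteration $(\mathbf A)$ (the DEBT control protocol) with stepsize $\gamma>0$ is \[\lambda[0]=0,\qquad f[t]=\arg\max_{f\in A}L(f,\lambda[t]),\qquad \lambda[t+1]=\lambda[t]+\gamma Rf[t]\qquad(t=0,1,2,\dots).\] Norms are Euclidean, and $\|R\|_{op}$ is the corresponding operator norm. \textbf{Proposition.} Assume that $\eta_{i,j}\ge\eta>0$ for all $(i,j)\in\mathcal N$ and that $0<\gamma<\eta/\|R\|_{op}^2$ (any $\gamma>0$ is allowed if $R=0$). Then $L(\cdot,\lambda)$ has a unique maximizer over $A$ for every $\lambda\in\mathbb R^E$, so that $D$ and the iteration $(\mathbf A)$ are well defined, and: \begin{itemize}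 \item for every minimizer $\lambda^*$ of $D$ over $\mathbb R^E$ and every $t\ge 1$, $\displaystyle D(\lambda[t])-D(\lambda^*)\le\frac{\|\lambda^*\|^2}{2\gamma t}$; \item $\lambda[t]$ converges, as $t\to\infty$, to some $\lambda^{**}\in\arg\min_{\lambda\in\mathbb R^E}D(\lambda)$; \item $(\mathbf P)$ has a unique solution $f^*$, and $f[t]\to f^*$ as $t\to\infty$. \end{itemize} -/

import Mathlib

open Filter Topology

/-- A payment channel network on the (linearly ordered) finite node set `V`, together with the
steady-state demand, the utilities and the regularizer weights. The edges of `graph` are the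
channels, and `paths i j` is the set of paths which the source-destination pair `(i, j)` may use.
A path may revisit nodes, but it traverses every channel at most once, so it is a trail. -/
structure PaymentNetwork (V : Type*) [LinearOrder V] [Fintype V] where
  graph : SimpleGraph V
  paths : ∀ i j : V, Finset (graph.Walk i j)
  isTrail : ∀ i j : V, ∀ p ∈ paths i j, p.IsTrail
  demand : V → V → ℝ
  demand_nonneg : ∀ i j, 0 ≤ demand i j
  utility : V → V → ℝ → ℝ
  utility_zero : ∀ i j, 0 < demand i j → utility i j 0 = 0
  utility_concave : ∀ i j, 0 < demand i j → ConcaveOn ℝ (Set.Icc 0 (demand i j)) (utility i j)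
  utility_mono : ∀ i j, 0 < demand i j → MonotoneOn (utility i j) (Set.Icc 0 (demand i j))
  /-- Differentiability on the closed interval, one-sided at the end points; in particular the
  right derivative at `0` is finite. -/
  utility_diff : ∀ i j, 0 < demand i j →
    DifferentiableOn ℝ (utility i j) (Set.Icc 0 (demand i j))
  weight : V → V → ℝ
  weight_nonneg : ∀ i j, 0 < demand i j → 0 ≤ weight i j

namespace PaymentNetwork

variable {V : Type*} [LinearOrder V] [Fintype V] (N : PaymentNetwork V)

/-- The channels `(u, v)`, with the lower node written first. -/
def Channel : Type _ := {e : V × V // e.1 < e.2 ∧ N.graph.Adj e.1 e.2}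

noncomputable instance : Fintype N.Channel :=
  have : Finite N.Channel := inferInstanceAs (Finite {e : V × V // _})
  Fintype.ofFinite _

/-- The transacting node pairs `(i, j)`, those with `a_{i,j} > 0`. -/
def Pair : Type _ := {s : V × V // 0 < N.demand s.1 s.2}

noncomputable instance : Fintype N.Pair :=
  have : Finite N.Pair := inferInstanceAs (Finite {s : V × V // _})
  Fintype.ofFinite _

/-- The paths `p_{i,j,k}` available to the transacting pair `s = (i, j)`. -/
abbrev Route (s : N.Pair) : Type _ := {p // p ∈ N.paths s.1.1 s.1.2}

/-- The set `P` of all paths of all transacting pairs, as pairs `⟨(i, j), p_{i,j,k}⟩`. -/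
abbrev PathIndex : Type _ := (s : N.Pair) × N.Route s

/-- Flow vectors `f ∈ ℝ^P`. -/
abbrev Flow : Type _ := EuclideanSpace ℝ N.PathIndex

/-- Price vectors `lam ∈ ℝ^E`. -/
abbrev Price : Type _ := EuclideanSpace ℝ N.Channel

open Classical in
/-- The routing matrix `R`: the entry at channel `(u, v)` and path `p` is `1` if `p` traverses the
channel in the direction `u → v`, `-1` if it traverses it in the direction `v → u`, and `0` if it
does not traverse it. -/
noncomputable def routing : Matrix N.Channel N.PathIndex ℝ := fun e p =>
  if e.1 ∈ p.2.1.darts.map (fun d => d.toProd) then 1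
  else if e.1.swap ∈ p.2.1.darts.map (fun d => d.toProd) then -1
  else 0

open Classical in
/-- The linear operator `f ↦ R f` between Euclidean spaces; its norm is the operator norm of `R`. -/
noncomputable def routingOp : N.Flow →L[ℝ] N.Price :=
  LinearMap.toContinuousLinearMap (Matrix.toEuclideanLin N.routing)

/-- The total flow `q_{i,j} = ∑ₖ f_{i,j,k}` of a transacting pair. -/
noncomputable def total (f : N.Flow) (s : N.Pair) : ℝ := ∑ k : N.Route s, f ⟨s, k⟩

/-- The set `A` of non-negative flows that satisfy the demand constraints. -/
def demandSet : Set N.Flow :=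
  {f | (∀ p, 0 ≤ f p) ∧ ∀ s : N.Pair, N.total f s ≤ N.demand s.1.1 s.1.2}

/-- The total utility `U(f)`. -/
noncomputable def totalUtility (f : N.Flow) : ℝ :=
  ∑ s : N.Pair, N.utility s.1.1 s.1.2 (N.total f s)

/-- The quadratic regularizer `H(f)`. -/
noncomputable def regularizer (f : N.Flow) : ℝ :=
  -∑ s : N.Pair, N.weight s.1.1 s.1.2 * ∑ k : N.Route s, (f ⟨s, k⟩) ^ 2

/-- The Lagrangian `L(f, lam) = U(f) + H(f) - lamᵀ R f`. -/
noncomputable def lagrangian (f : N.Flow) (lam : N.Price) : ℝ :=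
  N.totalUtility f + N.regularizer f - inner ℝ lam (N.routingOp f)

/-- The set `F(lam)` of maximizers over `A` of the Lagrangian at the price vector `lam`. -/
def bestResponse (lam : N.Price) : Set N.Flow :=
  {f | f ∈ N.demandSet ∧ ∀ g ∈ N.demandSet, N.lagrangian g lam ≤ N.lagrangian f lam}

/-- The dual function `D(lam) = max_{f ∈ A} L(f, lam)`. -/
noncomputable def dual (lam : N.Price) : ℝ :=
  sSup ((fun f => N.lagrangian f lam) '' N.demandSet)

/-- `lam` is a minimizer of the dual function over `ℝ^E`. -/
def IsDualOptimal (lam : N.Price) : Prop := ∀ ν : N.Price, N.dual lam ≤ N.dual ν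

/-- Feasible flows: demand constraints and detailed balance `R f = 0`. -/
def feasible : Set N.Flow := {f | f ∈ N.demandSet ∧ N.routingOp f = 0}

/-- `f` solves the utility maximization problem: maximize `U(f) + H(f)` over the feasible flows. -/
def IsPrimalOptimal (f : N.Flow) : Prop :=
  f ∈ N.feasible ∧ ∀ g ∈ N.feasible,
    N.totalUtility g + N.regularizer g ≤ N.totalUtility f + N.regularizer f

/-- `(lam, f)` is a run of the dual gradient iteration with stepsize `γ`: prices start at zero, the
flows maximize the Lagrangian at the current prices, and the prices move along `R f[t]`. -/
structure IsRun (γ : ℝ) (lam : ℕ → N.Price) (f : ℕ → N.Flow) : Prop where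
  init : lam 0 = 0
  flow : ∀ t, f t ∈ N.bestResponse (lam t)
  step : ∀ t, lam (t + 1) = lam t + γ • N.routingOp (f t)

end PaymentNetwork

/-!
The iteration is gradient descent on the dual function `D`, and everything follows from strong
concavity of the objective `U + H`, which holds because every weight is at least `η`.

Since the demand set `A` is compact and `L(·, λ)` is strongly concave, there is exactly one best
response `f(λ)`, and `L(·, λ)` falls off by at least `η / 2 * ‖f(λ) - g‖ ^ 2` at any other `g ∈ A`
(`PaymentNetwork.lagrangian_add_sq_dist_le_dual`). Hence `-R f(λ)` is a subgradient of `D` at `λ`,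
and `D` has a quadratic upper bound with constant `‖R‖ ^ 2 / (2 * η)`
(`PaymentNetwork.dual_le_quadratic`). For a stepsize `γ ≤ η / ‖R‖ ^ 2` one step thus decreases `D`
by at least `γ / 2 * ‖R f[t]‖ ^ 2`. With the subgradient inequality this shows that
`‖λ[t] - λ*‖ ^ 2` drops by `2 * γ * (D(λ[t+1]) - D(λ*))`, which telescopes to the rate
(`value_sub_le_of_sufficient_decrease`), and which makes the iterates approach every minimizer
monotonically, so that they converge to one of them as soon as a minimizer exists
(`exists_tendsto_minimizer_of_sufficient_decrease`).

A dual minimizer exists by strong duality. All constraints of the primal problem are affine, and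
the utilities are differentiable up to the end points, so the derivative of the objective at a
primal optimum is non-positive on the polyhedral cone of feasible directions, and Farkas' lemma
yields a multiplier (`ConcaveOn.exists_multiplier`). This also gives `D(λ*) = U(f*) + H(f*)`. As
`R f* = 0`, the quadratic fall-off at `λ[t]` then reads
`η / 2 * ‖f[t] - f*‖ ^ 2 ≤ D(λ[t]) - D(λ*)`, so the flows converge to `f*`.
-/

/-! ### Lagrange multipliers for concave maximization over a polyhedron -/

/-- **Farkas' lemma** with equality constraints, over an arbitrary real vector space: if `c x ≤ 0`
whenever `T x = 0` and all `a i x ≤ 0`, then `c` is a non-negative combination of the `a i` plus a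
functional that factors through `T`. -/
theorem exists_nonneg_combination_of_forall_le_zero {ι W F : Type*} [AddCommGroup W] [Module ℝ W]
    [AddCommGroup F] [Module ℝ F] (T : W →ₗ[ℝ] F) (s : Finset ι) (a : ι → W →ₗ[ℝ] ℝ)
    (c : W →ₗ[ℝ] ℝ) (h : ∀ x, T x = 0 → (∀ i ∈ s, a i x ≤ 0) → c x ≤ 0) :
    ∃ u : ι → ℝ, (∀ i, 0 ≤ u i) ∧ ∃ μ : F →ₗ[ℝ] ℝ,
      ∀ x, c x = ∑ i ∈ s, u i * a i x + μ (T x) := by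
  classical
  induction s using Finset.induction_on generalizing a c with
  | empty =>
    have hc : c ∈ T.ker.dualAnnihilator := by
      rw [Submodule.mem_dualAnnihilator]
      intro x hx
      have hx' : T x = 0 := hx
      have h₁ := h x hx' (by simp)
      have h₂ := h (-x) (by simp [hx']) (by simp)
      rw [map_neg] at h₂
      linarith
    rw [← LinearMap.range_dualMap_eq_dualAnnihilator_ker] at hc
    obtain ⟨μ, rfl⟩ := hc
    exact ⟨0, fun _ => le_rfl, μ, fun x => by simp⟩
  | insert j s hj ih =>
    by_cases hcase : ∀ x, T x = 0 → (∀ i ∈ s, a i x ≤ 0) → c x ≤ 0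
    · obtain ⟨u, hu, μ, hμ⟩ := ih a c hcase
      refine ⟨fun i => if i = j then 0 else u i, fun i => ?_, μ, fun x => ?_⟩
      · dsimp only
        split_ifs
        exacts [le_rfl, hu i]
      · rw [hμ x, Finset.sum_insert hj]
        simp only [if_true, zero_mul, zero_add]
        congr 1
        refine Finset.sum_congr rfl fun i hi => ?_
        rw [if_neg (ne_of_mem_of_not_mem hi hj)]
    · push Not at hcase
      obtain ⟨z, hTz, hz, hcz⟩ := hcase
      have hjz : 0 < a j z := by
        by_contra hle
        refine absurd (h z hTz fun i hi => ?_) (not_le.2 hcz)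
        rcases Finset.mem_insert.1 hi with rfl | hi
        exacts [not_lt.1 hle, hz i hi]
      -- Normalize to `a j x₀ = 1`; the projection along `x₀` onto the kernel of `a j` removes the
      -- constraint `j`.
      set x₀ : W := (a j z)⁻¹ • z with hx₀
      have hj₀ : a j x₀ = 1 := by simp [hx₀, hjz.ne']
      have hT₀ : T x₀ = 0 := by simp [hx₀, hTz]
      have ha₀ : ∀ i ∈ s, a i x₀ ≤ 0 := fun i hi => by
        simpa [hx₀] using mul_nonpos_of_nonneg_of_nonpos (inv_nonneg.2 hjz.le) (hz i hi)
      have hc₀ : 0 ≤ c x₀ := by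
        simpa [hx₀] using mul_nonneg (inv_nonneg.2 hjz.le) hcz.le
      obtain ⟨u, hu, μ, hμ⟩ := ih (fun i => a i - a i x₀ • a j) (c - c x₀ • a j)
        (fun x hTx hx => by
          have key := h (x - a j x • x₀) (by simp [hTx, hT₀]) (fun i hi => by
            rcases Finset.mem_insert.1 hi with rfl | hi
            · simp [hj₀]
            · have := hx i hi
              simp only [LinearMap.sub_apply, LinearMap.smul_apply, smul_eq_mul] at this
              simp only [map_sub, map_smul, smul_eq_mul]
              linarith)
          simp only [map_sub, map_smul, smul_eq_mul] at key
          simp only [LinearMap.sub_apply, LinearMap.smul_apply, smul_eq_mul]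
          linarith)
      have hsum : ∑ i ∈ s, u i * a i x₀ ≤ 0 :=
        Finset.sum_nonpos fun i hi => mul_nonpos_of_nonneg_of_nonpos (hu i) (ha₀ i hi)
      refine ⟨fun i => if i = j then c x₀ - ∑ i ∈ s, u i * a i x₀ else u i, fun i => ?_, μ,
        fun x => ?_⟩
      · dsimp only
        split_ifs
        exacts [by linarith, hu i]
      · have hx := hμ x
        simp only [LinearMap.sub_apply, LinearMap.smul_apply, smul_eq_mul, mul_sub,
          Finset.sum_sub_distrib] at hx
        have hs : ∑ i ∈ s, (if i = j then c x₀ - ∑ i ∈ s, u i * a i x₀ else u i) * a i x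
            = ∑ i ∈ s, u i * a i x :=
          Finset.sum_congr rfl fun i hi => by rw [if_neg (ne_of_mem_of_not_mem hi hj)]
        rw [Finset.sum_insert hj, hs]
        simp only [if_true, sub_mul, Finset.sum_mul, ← mul_assoc] at hx ⊢
        linarith

/-- A concave function lies below its tangent at any point of its domain, also at a boundary
point. -/
theorem ConcaveOn.le_add_of_hasFDerivWithinAt {E : Type*} [NormedAddCommGroup E] [NormedSpace ℝ E]
    {s : Set E} {f : E → ℝ} {f' : E →L[ℝ] ℝ} {x y : E} (hf : ConcaveOn ℝ s f) (hx : x ∈ s)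
    (hy : y ∈ s) (hf' : HasFDerivWithinAt f f' s x) : f y ≤ f x + f' (y - x) := by
  have hmaps : Set.MapsTo (AffineMap.lineMap x y : ℝ → E) (Set.Icc 0 1) s := fun t ht =>
    hf.1.lineMap_mem hx hy ht
  have hconc : ConcaveOn ℝ (Set.Icc (0 : ℝ) 1) (f ∘ AffineMap.lineMap x y) :=
    (hf.comp_affineMap (AffineMap.lineMap x y)).subset hmaps (convex_Icc 0 1)
  have hderiv : HasDerivWithinAt (f ∘ AffineMap.lineMap x y) (f' (y - x)) (Set.Icc (0 : ℝ) 1) 0 :=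
    HasFDerivWithinAt.comp_hasDerivWithinAt (0 : ℝ) (by simpa using hf')
      AffineMap.hasDerivWithinAt_lineMap hmaps
  have := hconc.slope_le_of_hasDerivWithinAt (by simp) (by simp) zero_lt_one hderiv
  simp only [slope_def_field, Function.comp_apply, AffineMap.lineMap_apply_one,
    AffineMap.lineMap_apply_zero, sub_zero, div_one] at this
  linarith

/-- Strong duality: for a concave maximization problem over a polyhedron `K` with an additional
linear constraint `T x = 0`, a maximizer `x₀` at which the objective is differentiable within `K`
admits a price vector at which the Lagrangian on `K` never exceeds the optimal value. No interior
point of `K` is needed, because all constraints are affine. -/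
theorem ConcaveOn.exists_multiplier {ι E F : Type*} [Finite ι] [NormedAddCommGroup E]
    [NormedSpace ℝ E] [NormedAddCommGroup F] [InnerProductSpace ℝ F] [FiniteDimensional ℝ F]
    {K : Set E} {φ : E → ℝ} {x₀ : E} {a : ι → E →L[ℝ] ℝ} {b : ι → ℝ} {T : E →L[ℝ] F}
    (hφ : ConcaveOn ℝ K φ) (hK : ∀ x, x ∈ K ↔ ∀ i, a i x ≤ b i)
    (hx₀ : x₀ ∈ K) (hT₀ : T x₀ = 0) (hmax : IsMaxOn φ {x | x ∈ K ∧ T x = 0} x₀)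
    (hdiff : DifferentiableWithinAt ℝ φ K x₀) :
    ∃ lam : F, ∀ x ∈ K, φ x - inner ℝ lam (T x) ≤ φ x₀ := by
  classical
  have := Fintype.ofFinite ι
  have hc := hdiff.hasFDerivWithinAt
  set c := fderivWithin ℝ φ K x₀
  set s : Finset ι := {i | a i x₀ = b i} with hs
  -- Moving from `x₀` along a direction that respects the active constraints and `ker T` stays
  -- feasible for a short time, so the derivative is non-positive along it.
  obtain ⟨u, hu, μ, hμ⟩ := exists_nonneg_combination_of_forall_le_zero (T : E →ₗ[ℝ] F) s
    (fun i => (a i : E →ₗ[ℝ] ℝ)) (c : E →ₗ[ℝ] ℝ) (fun d hTd hd => by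
      replace hTd : T d = 0 := hTd
      have hev : ∀ᶠ t : ℝ in 𝓝[>] 0, x₀ + t • d ∈ {x | x ∈ K ∧ T x = 0} := by
        have hall : ∀ i, ∀ᶠ t : ℝ in 𝓝[>] 0, a i (x₀ + t • d) ≤ b i := by
          intro i
          by_cases hi : a i x₀ = b i
          · have hdi : a i d ≤ 0 := hd i (by simp [hs, hi])
            filter_upwards [self_mem_nhdsWithin] with t ht
            have ht' : (0 : ℝ) < t := ht
            rw [map_add, map_smul, smul_eq_mul, hi]
            nlinarith
          · have hlt : a i x₀ < b i := lt_of_le_of_ne ((hK x₀).1 hx₀ i) hi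
            have hcont : ContinuousAt (fun t : ℝ => a i (x₀ + t • d)) 0 := by fun_prop
            have := hcont.eventually_lt (continuousAt_const (y := b i)) (by simpa using hlt)
            exact (this.filter_mono nhdsWithin_le_nhds).mono fun t ht => ht.le
        filter_upwards [eventually_all.2 hall] with t ht
        exact ⟨(hK _).2 ht, by simp [hTd, hT₀]⟩
      exact hmax.localize.hasFDerivWithinAt_nonpos (hc.mono fun x hx => hx.1)
        (mem_posTangentConeAt_of_frequently_mem hev.frequently))
  have : CompleteSpace F := FiniteDimensional.complete ℝ F
  refine ⟨(InnerProductSpace.toDual ℝ F).symm (LinearMap.toContinuousLinearMap μ),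
    fun x hx => ?_⟩
  have h₁ := hφ.le_add_of_hasFDerivWithinAt hx₀ hx hc
  have h₂ : c (x - x₀) = ∑ i ∈ s, u i * a i (x - x₀) + μ (T (x - x₀)) := hμ (x - x₀)
  have h₃ : ∑ i ∈ s, u i * a i (x - x₀) ≤ 0 := by
    refine Finset.sum_nonpos fun i hi => mul_nonpos_of_nonneg_of_nonpos (hu i) ?_
    have hi' : a i x₀ = b i := by simpa [hs] using hi
    have := (hK x).1 hx i
    rw [map_sub]
    linarith
  rw [map_sub T, hT₀, sub_zero] at h₂
  rw [InnerProductSpace.toDual_symm_apply, LinearMap.coe_toContinuousLinearMap']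
  linarith

/-! ### Maximizers of strongly concave functions -/

/-- A strongly concave function falls off at least quadratically away from a maximizer. Comparing
with the midpoint gives half of the optimal constant. -/
theorem StrongConcaveOn.add_sq_dist_le_of_isMaxOn {E : Type*} [NormedAddCommGroup E]
    [NormedSpace ℝ E] {s : Set E} {m : ℝ} {f : E → ℝ} {x y : E} (hf : StrongConcaveOn s m f)
    (hx : x ∈ s) (hmax : IsMaxOn f s x) (hy : y ∈ s) : f y + m / 4 * ‖x - y‖ ^ 2 ≤ f x := by
  obtain ⟨hs, hineq⟩ := hf
  have h₁ := hineq hx hy (a := 1 / 2) (b := 1 / 2) (by norm_num) (by norm_num) (by norm_num)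
  have h₂ : f ((1 / 2 : ℝ) • x + (1 / 2 : ℝ) • y) ≤ f x :=
    hmax (hs hx hy (by norm_num) (by norm_num) (by norm_num))
  simp only [smul_eq_mul] at h₁
  linarith

/-! ### Gradient descent with sufficient decrease -/

theorem antitone_of_sufficient_decrease {F : Type*} [NormedAddCommGroup F] {D : F → ℝ} {γ : ℝ}
    {lam r : ℕ → F} (hγ : 0 < γ)
    (hdec : ∀ t, D (lam (t + 1)) ≤ D (lam t) - γ / 2 * ‖r t‖ ^ 2) :
    Antitone fun t => D (lam t) :=
  antitone_nat_of_succ_le fun t => (hdec t).trans (sub_le_self _ (by positivity))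

section Descent

variable {F : Type*} [NormedAddCommGroup F] [InnerProductSpace ℝ F] {D : F → ℝ} {γ : ℝ}
  {lam r : ℕ → F}

/-- One step of gradient descent, `-r t` being a subgradient of `D` at `lam t`: the squared
distance to a reference point `μ` drops by at least `2γ` times the excess of the new value over
`D μ`. -/
theorem sq_dist_succ_le_of_sufficient_decrease (hγ : 0 < γ)
    (hstep : ∀ t, lam (t + 1) = lam t + γ • r t)
    (hsub : ∀ t μ, D (lam t) - inner ℝ (μ - lam t) (r t) ≤ D μ)
    (hdec : ∀ t, D (lam (t + 1)) ≤ D (lam t) - γ / 2 * ‖r t‖ ^ 2) (μ : F) (t : ℕ) :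
    ‖lam (t + 1) - μ‖ ^ 2 ≤ ‖lam t - μ‖ ^ 2 - 2 * γ * (D (lam (t + 1)) - D μ) := by
  have h₁ := hsub t μ
  have h₂ := hdec t
  have h₃ : ‖lam (t + 1) - μ‖ ^ 2
      = ‖lam t - μ‖ ^ 2 + 2 * (γ * inner ℝ (lam t - μ) (r t)) + γ ^ 2 * ‖r t‖ ^ 2 := by
    rw [hstep t, add_sub_right_comm, norm_add_sq_real, real_inner_smul_right, norm_smul, mul_pow,
      Real.norm_eq_abs, sq_abs]
  have h₄ : inner ℝ (μ - lam t) (r t) = -inner ℝ (lam t - μ) (r t) := by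
    rw [← inner_neg_left, neg_sub]
  rw [h₄] at h₁
  nlinarith

/-- The `O(1 / t)` rate: the one-step inequalities telescope, and the last value is the smallest. -/
theorem value_sub_le_of_sufficient_decrease (hγ : 0 < γ)
    (hstep : ∀ t, lam (t + 1) = lam t + γ • r t)
    (hsub : ∀ t μ, D (lam t) - inner ℝ (μ - lam t) (r t) ≤ D μ)
    (hdec : ∀ t, D (lam (t + 1)) ≤ D (lam t) - γ / 2 * ‖r t‖ ^ 2) (μ : F) {t : ℕ} (ht : 1 ≤ t) :
    D (lam t) - D μ ≤ ‖lam 0 - μ‖ ^ 2 / (2 * γ * t) := by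
  have hanti := antitone_of_sufficient_decrease hγ hdec
  have key : ∀ n : ℕ, ‖lam n - μ‖ ^ 2 + 2 * γ * (n * (D (lam n) - D μ)) ≤ ‖lam 0 - μ‖ ^ 2 := by
    intro n
    induction n with
    | zero => simp
    | succ n ih =>
      have h₁ := sq_dist_succ_le_of_sufficient_decrease hγ hstep hsub hdec μ n
      have h₂ : γ * (n * D (lam (n + 1))) ≤ γ * (n * D (lam n)) := by
        have := hanti n.le_succ
        dsimp only [Nat.succ_eq_add_one] at this
        gcongr
      push_cast
      linarith
  have ht' : (0 : ℝ) < t := by exact_mod_cast ht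
  rw [le_div_iff₀ (by positivity)]
  have := key t
  nlinarith [sq_nonneg ‖lam t - μ‖]

theorem tendsto_value_of_sufficient_decrease (hγ : 0 < γ)
    (hstep : ∀ t, lam (t + 1) = lam t + γ • r t)
    (hsub : ∀ t μ, D (lam t) - inner ℝ (μ - lam t) (r t) ≤ D μ)
    (hdec : ∀ t, D (lam (t + 1)) ≤ D (lam t) - γ / 2 * ‖r t‖ ^ 2) {μ : F}
    (hμ : ∀ ν, D μ ≤ D ν) : Tendsto (fun t => D (lam t)) atTop (𝓝 (D μ)) := by
  have hlim : Tendsto (fun t : ℕ => D μ + ‖lam 0 - μ‖ ^ 2 / (2 * γ * t)) atTop (𝓝 (D μ)) := by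
    have : Tendsto (fun t : ℕ => 2 * γ * (t : ℝ)) atTop atTop :=
      tendsto_natCast_atTop_atTop.const_mul_atTop (by positivity)
    simpa using tendsto_const_nhds.add (this.const_div_atTop (‖lam 0 - μ‖ ^ 2))
  refine tendsto_of_tendsto_of_tendsto_of_le_of_le' tendsto_const_nhds hlim
    (Eventually.of_forall fun t => hμ _) ?_
  filter_upwards [eventually_ge_atTop 1] with t ht
  have := value_sub_le_of_sufficient_decrease hγ hstep hsub hdec μ ht
  linarith

/-- The iterates converge to a minimizer as soon as one exists: the distances to any minimizer
decrease, so the iterates are bounded, every cluster point is a minimizer, and the distances to a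
cluster point decrease to zero. -/
theorem exists_tendsto_minimizer_of_sufficient_decrease [ProperSpace F] (hγ : 0 < γ)
    (hstep : ∀ t, lam (t + 1) = lam t + γ • r t)
    (hsub : ∀ t μ, D (lam t) - inner ℝ (μ - lam t) (r t) ≤ D μ)
    (hdec : ∀ t, D (lam (t + 1)) ≤ D (lam t) - γ / 2 * ‖r t‖ ^ 2)
    (hlsc : LowerSemicontinuous D) {μ : F} (hμ : ∀ ν, D μ ≤ D ν) :
    ∃ κ, (∀ ν, D κ ≤ D ν) ∧ Tendsto lam atTop (𝓝 κ) := by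
  have hfejer : ∀ κ, (∀ ν, D κ ≤ D ν) → Antitone fun t => ‖lam t - κ‖ ^ 2 := fun κ hκ =>
    antitone_nat_of_succ_le fun t =>
      (sq_dist_succ_le_of_sufficient_decrease hγ hstep hsub hdec κ t).trans
        (sub_le_self _ (mul_nonneg (by positivity) (sub_nonneg.2 (hκ _))))
  have hmem : ∀ t, lam t ∈ Metric.closedBall μ ‖lam 0 - μ‖ := fun t => by
    rw [Metric.mem_closedBall, dist_eq_norm]
    exact (sq_le_sq₀ (norm_nonneg _) (norm_nonneg _)).1 (hfejer μ hμ t.zero_le)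
  obtain ⟨κ, -, σ, hσ, hκ⟩ := tendsto_subseq_of_bounded Metric.isBounded_closedBall hmem
  have hval := tendsto_value_of_sufficient_decrease hγ hstep hsub hdec hμ
  have hκopt : ∀ ν, D κ ≤ D ν := by
    refine fun ν => le_trans (le_of_forall_lt fun y hy => ?_) (hμ ν)
    obtain ⟨z, hyz, hz⟩ := exists_between hy
    have hev : ∀ᶠ n in atTop, z ≤ D (lam (σ n)) :=
      (hκ.eventually (hlsc κ z hz)).mono fun n hn => le_of_lt hn
    exact hyz.trans_le (ge_of_tendsto (hval.comp hσ.tendsto_atTop) hev)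
  refine ⟨κ, hκopt, ?_⟩
  have hsubseq : Tendsto ((fun t => ‖lam t - κ‖ ^ 2) ∘ σ) atTop (𝓝 0) := by
    have := (tendsto_iff_norm_sub_tendsto_zero.1 hκ).pow 2
    simpa [Function.comp_def] using this
  have hsq := (tendsto_iff_tendsto_subseq_of_antitone (hfejer κ hκopt) hσ.tendsto_atTop).2 hsubseq
  rw [tendsto_iff_norm_sub_tendsto_zero]
  simpa using hsq.sqrt

end Descent

namespace PaymentNetwork

variable {V : Type*} [LinearOrder V] [Fintype V] (N : PaymentNetwork V)

/-! ### The set of flows that satisfy the demand constraints -/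

/-- The total flow of a pair as a continuous linear functional. -/
noncomputable def totalCLM (s : N.Pair) : N.Flow →L[ℝ] ℝ :=
  ∑ k : N.Route s, EuclideanSpace.proj (⟨s, k⟩ : N.PathIndex)

theorem totalCLM_apply (s : N.Pair) (f : N.Flow) : N.totalCLM s f = N.total f s := by
  simp [totalCLM, total, sum_apply]

/-- The left-hand sides of the demand constraints, non-negativity being written as `-f p ≤ 0`. -/
noncomputable def constraint : N.PathIndex ⊕ N.Pair → N.Flow →L[ℝ] ℝ :=
  Sum.elim (fun p => -EuclideanSpace.proj p) N.totalCLM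

/-- The right-hand sides of the demand constraints. -/
def bound : N.PathIndex ⊕ N.Pair → ℝ :=
  Sum.elim (fun _ => 0) fun s => N.demand s.1.1 s.1.2

theorem mem_demandSet_iff (f : N.Flow) :
    f ∈ N.demandSet ↔ ∀ i, N.constraint i f ≤ N.bound i := by
  simp [demandSet, constraint, bound, Sum.forall, totalCLM_apply]

theorem convex_demandSet : Convex ℝ N.demandSet := by
  have : N.demandSet = ⋂ i, {f | N.constraint i f ≤ N.bound i} := by
    ext f
    simp [mem_demandSet_iff]
  rw [this]
  exact convex_iInter fun i => convex_halfSpace_le (N.constraint i).isLinear _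

theorem isClosed_demandSet : IsClosed N.demandSet := by
  have : N.demandSet = ⋂ i, {f | N.constraint i f ≤ N.bound i} := by
    ext f
    simp [mem_demandSet_iff]
  rw [this]
  exact isClosed_iInter fun i => isClosed_le (N.constraint i).continuous continuous_const

theorem zero_mem_demandSet : (0 : N.Flow) ∈ N.demandSet :=
  ⟨fun p => le_rfl, fun s => by simpa [total] using N.demand_nonneg _ _⟩

theorem mapsTo_totalCLM (s : N.Pair) :
    Set.MapsTo (N.totalCLM s) N.demandSet (Set.Icc 0 (N.demand s.1.1 s.1.2)) := fun f hf => by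
  rw [totalCLM_apply]
  exact ⟨Finset.sum_nonneg fun k _ => hf.1 _, hf.2 s⟩

theorem isCompact_demandSet : IsCompact N.demandSet := by
  refine Metric.isCompact_of_isClosed_isBounded N.isClosed_demandSet ?_
  refine isBounded_iff_forall_norm_le.2 ⟨√(∑ p : N.PathIndex, N.demand p.1.1.1 p.1.1.2 ^ 2),
    fun f hf => Real.le_sqrt_of_sq_le ?_⟩
  rw [EuclideanSpace.real_norm_sq_eq]
  refine Finset.sum_le_sum fun p _ => pow_le_pow_left₀ (hf.1 p) (le_trans ?_ (hf.2 p.1)) 2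
  exact Finset.single_le_sum (f := fun k : N.Route p.1 => f ⟨p.1, k⟩) (fun k _ => hf.1 _)
    (Finset.mem_univ p.2)

theorem isCompact_feasible : IsCompact N.feasible :=
  N.isCompact_demandSet.inter_right
    (isClosed_eq N.routingOp.continuous continuous_const)

/-! ### The regularized utility -/

/-- The primal objective `U(f) + H(f)`. -/
noncomputable def objective (f : N.Flow) : ℝ := N.totalUtility f + N.regularizer f

theorem lagrangian_eq (f : N.Flow) (lam : N.Price) :
    N.lagrangian f lam = N.objective f - inner ℝ lam (N.routingOp f) := rfl

theorem differentiableOn_objective : DifferentiableOn ℝ N.objective N.demandSet := by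
  have hU : DifferentiableOn ℝ N.totalUtility N.demandSet := by
    refine DifferentiableOn.fun_sum fun s _ => ?_
    simp only [← totalCLM_apply]
    exact (N.utility_diff _ _ s.2).comp (N.totalCLM s).differentiable.differentiableOn
      (N.mapsTo_totalCLM s)
  have hH : Differentiable ℝ N.regularizer := by
    unfold regularizer
    fun_prop
  exact hU.add hH.differentiableOn

theorem concaveOn_totalUtility : ConcaveOn ℝ N.demandSet N.totalUtility := by
  have hs : ∀ s : N.Pair,
      ConcaveOn ℝ N.demandSet fun f => N.utility s.1.1 s.1.2 (N.total f s) := fun s => by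
    simp only [← totalCLM_apply]
    exact ((N.utility_concave _ _ s.2).comp_linearMap (N.totalCLM s : N.Flow →ₗ[ℝ] ℝ)).subset
      (N.mapsTo_totalCLM s) N.convex_demandSet
  refine ⟨N.convex_demandSet, fun f hf g hg a b ha hb hab => ?_⟩
  simp only [totalUtility, Finset.smul_sum, ← Finset.sum_add_distrib]
  exact Finset.sum_le_sum fun s _ => (hs s).2 hf hg ha hb hab

/-- If all weights are at least `η`, the quadratic regularizer makes the objective strongly
concave. The modulus is `2 * η` since strong concavity with modulus `m` compares with
`m / 2 * ‖f‖ ^ 2`. -/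
theorem strongConcaveOn_objective {η : ℝ}
    (hweight : ∀ i j : V, 0 < N.demand i j → η ≤ N.weight i j) :
    StrongConcaveOn N.demandSet (2 * η) N.objective := by
  rw [strongConcaveOn_iff_convex]
  have hsplit : ∀ f : N.Flow, N.objective f + 2 * η / 2 * ‖f‖ ^ 2
      = N.totalUtility f
        + ∑ p : N.PathIndex, (η - N.weight p.1.1.1 p.1.1.2) * f p ^ 2 := fun f => by
    simp only [objective, regularizer, EuclideanSpace.real_norm_sq_eq, Fintype.sum_sigma, sub_mul,
      Finset.sum_sub_distrib, Finset.mul_sum]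
    ring_nf
  simp only [hsplit]
  refine N.concaveOn_totalUtility.add ⟨N.convex_demandSet, fun f _ g _ a b ha hb hab => ?_⟩
  simp only [Finset.smul_sum, ← Finset.sum_add_distrib]
  refine Finset.sum_le_sum fun p _ => ?_
  have hsq : (a • f p + b • g p) ^ 2 ≤ a • f p ^ 2 + b • g p ^ 2 :=
    (even_two.convexOn_pow (𝕜 := ℝ)).2 (Set.mem_univ _) (Set.mem_univ _) ha hb hab
  have hw := hweight _ _ p.1.2
  simp only [smul_eq_mul, PiLp.add_apply, PiLp.smul_apply] at hsq ⊢
  nlinarith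

/-- Subtracting the linear price term from the objective does not affect strong concavity. -/
theorem strongConcaveOn_lagrangian {η : ℝ}
    (hweight : ∀ i j : V, 0 < N.demand i j → η ≤ N.weight i j) (lam : N.Price) :
    StrongConcaveOn N.demandSet (2 * η) fun f => N.lagrangian f lam := by
  obtain ⟨hconv, hobj⟩ := N.strongConcaveOn_objective hweight
  refine ⟨hconv, fun f hf g hg a b ha hb hab => ?_⟩
  have := hobj hf hg ha hb hab
  simp only [lagrangian_eq, map_add, map_smul, inner_add_right, real_inner_smul_right,
    smul_eq_mul] at this ⊢
  linarith

/-! ### Best responses and the dual function -/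

theorem exists_mem_bestResponse (lam : N.Price) : ∃ f, f ∈ N.bestResponse lam := by
  have hcont : ContinuousOn (fun f => N.lagrangian f lam) N.demandSet := by
    simp only [lagrangian_eq]
    exact N.differentiableOn_objective.continuousOn.sub (by fun_prop)
  obtain ⟨f, hf, hmax⟩ :=
    N.isCompact_demandSet.exists_isMaxOn ⟨0, N.zero_mem_demandSet⟩ hcont
  exact ⟨f, hf, fun g hg => hmax hg⟩

variable {N}

theorem dual_eq_of_mem_bestResponse {lam : N.Price} {f : N.Flow} (hf : f ∈ N.bestResponse lam) :
    N.dual lam = N.lagrangian f lam :=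
  IsGreatest.csSup_eq ⟨Set.mem_image_of_mem _ hf.1, Set.forall_mem_image.2 fun g hg => hf.2 g hg⟩

theorem lagrangian_le_dual {g : N.Flow} (hg : g ∈ N.demandSet) (lam : N.Price) :
    N.lagrangian g lam ≤ N.dual lam := by
  obtain ⟨f, hf⟩ := N.exists_mem_bestResponse lam
  rw [dual_eq_of_mem_bestResponse hf]
  exact hf.2 g hg

/-- The Lagrangian at the price vector `lam` falls off quadratically away from a best response. -/
theorem lagrangian_add_sq_dist_le_dual {η : ℝ}
    (hweight : ∀ i j : V, 0 < N.demand i j → η ≤ N.weight i j) {lam : N.Price} {f g : N.Flow}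
    (hf : f ∈ N.bestResponse lam) (hg : g ∈ N.demandSet) :
    N.lagrangian g lam + η / 2 * ‖f - g‖ ^ 2 ≤ N.dual lam := by
  have := (N.strongConcaveOn_lagrangian hweight lam).add_sq_dist_le_of_isMaxOn hf.1
    (isMaxOn_iff.2 hf.2) hg
  rw [dual_eq_of_mem_bestResponse hf]
  linarith

theorem eq_of_mem_bestResponse {η : ℝ} (hη : 0 < η)
    (hweight : ∀ i j : V, 0 < N.demand i j → η ≤ N.weight i j) {lam : N.Price} {f g : N.Flow}
    (hf : f ∈ N.bestResponse lam) (hg : g ∈ N.bestResponse lam) : f = g := by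
  have := lagrangian_add_sq_dist_le_dual hweight hf hg.1
  rw [dual_eq_of_mem_bestResponse hg] at this
  have hsq : ‖f - g‖ ^ 2 ≤ 0 := by
    by_contra! hpos
    have := mul_pos (half_pos hη) hpos
    linarith
  simpa [sub_eq_zero] using hsq.antisymm (sq_nonneg _)

/-- If `f` is a best response to `lam`, then `-R f` is a subgradient of the dual function at
`lam`. -/
theorem dual_sub_inner_le_dual {lam : N.Price} {f : N.Flow} (hf : f ∈ N.bestResponse lam)
    (ν : N.Price) : N.dual lam - inner ℝ (ν - lam) (N.routingOp f) ≤ N.dual ν := by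
  have h := lagrangian_le_dual hf.1 ν
  rw [dual_eq_of_mem_bestResponse hf]
  rw [lagrangian_eq] at h ⊢
  rw [inner_sub_left]
  linarith

/-- Quadratic upper bound on the dual function around `lam`, of the kind that a Lipschitz gradient
gives. Strong concavity controls the change of the best response, and completing the square
removes it. -/
theorem dual_le_quadratic {η : ℝ} (hη : 0 < η)
    (hweight : ∀ i j : V, 0 < N.demand i j → η ≤ N.weight i j) {lam : N.Price} {f : N.Flow}
    (hf : f ∈ N.bestResponse lam) (ν : N.Price) :
    N.dual ν ≤ N.dual lam - inner ℝ (ν - lam) (N.routingOp f)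
      + ‖N.routingOp‖ ^ 2 / (2 * η) * ‖ν - lam‖ ^ 2 := by
  obtain ⟨g, hg⟩ := N.exists_mem_bestResponse ν
  have hgrowth := lagrangian_add_sq_dist_le_dual hweight hf hg.1
  have hcross : inner ℝ (ν - lam) (N.routingOp (f - g))
      ≤ ‖ν - lam‖ * (‖N.routingOp‖ * ‖f - g‖) :=
    (real_inner_le_norm _ _).trans (by gcongr; exact N.routingOp.le_opNorm _)
  have hsquare : ‖ν - lam‖ * (‖N.routingOp‖ * ‖f - g‖)
      ≤ η / 2 * ‖f - g‖ ^ 2 + ‖N.routingOp‖ ^ 2 / (2 * η) * ‖ν - lam‖ ^ 2 := by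
    have : 0 ≤ (η * ‖f - g‖ - ‖N.routingOp‖ * ‖ν - lam‖) ^ 2 / (2 * η) := by positivity
    have hexp : (η * ‖f - g‖ - ‖N.routingOp‖ * ‖ν - lam‖) ^ 2 / (2 * η)
        = η / 2 * ‖f - g‖ ^ 2 + ‖N.routingOp‖ ^ 2 / (2 * η) * ‖ν - lam‖ ^ 2
          - ‖ν - lam‖ * (‖N.routingOp‖ * ‖f - g‖) := by
      field_simp
      ring
    linarith
  rw [dual_eq_of_mem_bestResponse hg]
  rw [lagrangian_eq] at hgrowth ⊢
  rw [map_sub, inner_sub_right] at hcross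
  simp only [inner_sub_left] at hcross ⊢
  linarith

theorem lowerSemicontinuous_dual : LowerSemicontinuous N.dual := fun lam y hy => by
  obtain ⟨f, hf⟩ := N.exists_mem_bestResponse lam
  replace hy : y < N.lagrangian f lam := dual_eq_of_mem_bestResponse hf ▸ hy
  have hcont : ContinuousAt (fun ν => N.lagrangian f ν) lam := by
    simp only [lagrangian_eq]
    fun_prop
  exact (hcont.eventually (lt_mem_nhds hy)).mono fun ν hν => hν.trans_le (lagrangian_le_dual hf.1 ν)

/-! ### Strong duality -/

theorem lagrangian_eq_objective_of_mem_feasible {f : N.Flow} (hf : f ∈ N.feasible)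
    (lam : N.Price) : N.lagrangian f lam = N.objective f := by
  rw [lagrangian_eq, hf.2, inner_zero_right, sub_zero]

variable (N) in
theorem exists_isPrimalOptimal : ∃ f, N.IsPrimalOptimal f := by
  have hcont : ContinuousOn N.objective N.feasible :=
    N.differentiableOn_objective.continuousOn.mono fun f hf => hf.1
  obtain ⟨f, hf, hmax⟩ := N.isCompact_feasible.exists_isMaxOn
    ⟨0, N.zero_mem_demandSet, map_zero _⟩ hcont
  exact ⟨f, hf, fun g hg => hmax hg⟩

/-- Strong duality: the dual minimum is attained, and it equals the primal optimal value. -/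
theorem IsPrimalOptimal.exists_isDualOptimal {η : ℝ} (hη : 0 < η)
    (hweight : ∀ i j : V, 0 < N.demand i j → η ≤ N.weight i j) {f : N.Flow}
    (hf : N.IsPrimalOptimal f) :
    ∃ lam, N.IsDualOptimal lam ∧ N.dual lam = N.objective f ∧ f ∈ N.bestResponse lam := by
  have hconc : ConcaveOn ℝ N.demandSet N.objective :=
    strongConcaveOn_zero.1 ((N.strongConcaveOn_objective hweight).mono (by positivity))
  obtain ⟨lam, hlam⟩ := hconc.exists_multiplier N.mem_demandSet_iff hf.1.1 hf.1.2
    (isMaxOn_iff.2 hf.2) (N.differentiableOn_objective f hf.1.1)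
  have hbest : f ∈ N.bestResponse lam := ⟨hf.1.1, fun g hg => by
    rw [lagrangian_eq_objective_of_mem_feasible hf.1]
    exact hlam g hg⟩
  have hval : N.dual lam = N.objective f := by
    rw [dual_eq_of_mem_bestResponse hbest, lagrangian_eq_objective_of_mem_feasible hf.1]
  refine ⟨lam, fun ν => ?_, hval, hbest⟩
  rw [hval, ← lagrangian_eq_objective_of_mem_feasible hf.1 ν]
  exact lagrangian_le_dual hf.1.1 ν

/-! ### The dual gradient iteration -/

/-- A step of the iteration decreases the dual function by at least half of what the linear model
predicts, since the stepsize bound halves the quadratic error term. -/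
theorem IsRun.dual_succ_le {η γ : ℝ} (hη : 0 < η)
    (hweight : ∀ i j : V, 0 < N.demand i j → η ≤ N.weight i j) (hγ : 0 < γ)
    (hstep : γ * ‖N.routingOp‖ ^ 2 ≤ η) {lam : ℕ → N.Price} {f : ℕ → N.Flow}
    (h : N.IsRun γ lam f) (t : ℕ) :
    N.dual (lam (t + 1)) ≤ N.dual (lam t) - γ / 2 * ‖N.routingOp (f t)‖ ^ 2 := by
  have hquad := dual_le_quadratic hη hweight (h.flow t) (lam (t + 1))
  rw [h.step t, add_sub_cancel_left, real_inner_smul_left, real_inner_self_eq_norm_sq, norm_smul,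
    mul_pow, Real.norm_eq_abs, sq_abs] at hquad
  rw [h.step t]
  have herr : ‖N.routingOp‖ ^ 2 / (2 * η) * (γ ^ 2 * ‖N.routingOp (f t)‖ ^ 2)
      ≤ γ / 2 * ‖N.routingOp (f t)‖ ^ 2 := by
    calc ‖N.routingOp‖ ^ 2 / (2 * η) * (γ ^ 2 * ‖N.routingOp (f t)‖ ^ 2)
        = (γ * ‖N.routingOp‖ ^ 2) / η * (γ / 2 * ‖N.routingOp (f t)‖ ^ 2) := by field_simp
      _ ≤ 1 * (γ / 2 * ‖N.routingOp (f t)‖ ^ 2) := by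
        gcongr
        exact (div_le_one hη).2 hstep
      _ = _ := one_mul _
  linarith

/-- The flows converge to the primal optimum `g`: their squared distance to `g` is bounded by the
gap between the dual values and the optimal value. -/
theorem IsRun.tendsto_flow {η γ : ℝ} (hη : 0 < η)
    (hweight : ∀ i j : V, 0 < N.demand i j → η ≤ N.weight i j) {lam : ℕ → N.Price}
    {f : ℕ → N.Flow} (h : N.IsRun γ lam f) {g : N.Flow} (hg : N.IsPrimalOptimal g)
    (hval : Tendsto (fun t => N.dual (lam t)) atTop (𝓝 (N.objective g))) :
    Tendsto f atTop (𝓝 g) := by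
  have hle : ∀ t, ‖f t - g‖ ^ 2 ≤ 2 / η * (N.dual (lam t) - N.objective g) := fun t => by
    have := lagrangian_add_sq_dist_le_dual hweight (h.flow t) hg.1.1
    rw [lagrangian_eq_objective_of_mem_feasible hg.1] at this
    rw [div_mul_eq_mul_div, le_div_iff₀ hη]
    linarith
  have hlim : Tendsto (fun t => 2 / η * (N.dual (lam t) - N.objective g)) atTop (𝓝 0) := by
    simpa using (hval.sub_const (N.objective g)).const_mul (2 / η)
  have hsq : Tendsto (fun t => ‖f t - g‖ ^ 2) atTop (𝓝 0) :=
    squeeze_zero (fun t => sq_nonneg _) hle hlim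
  rw [tendsto_iff_norm_sub_tendsto_zero]
  simpa using hsq.sqrt

end PaymentNetwork

theorem mainTheorem1 {V : Type*} [LinearOrder V] [Fintype V] (N : PaymentNetwork V)
    (η : ℝ) (hη : 0 < η) (hweight : ∀ i j : V, 0 < N.demand i j → η ≤ N.weight i j)
    (γ : ℝ) (hγ : 0 < γ) (hstep : γ * ‖N.routingOp‖ ^ 2 < η) :
    (∀ ν : N.Price, ∃! g : N.Flow, g ∈ N.bestResponse ν) ∧
    ∀ (lam : ℕ → N.Price) (f : ℕ → N.Flow), N.IsRun γ lam f →
      (∀ lamStar : N.Price, N.IsDualOptimal lamStar → ∀ t : ℕ, 1 ≤ t →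
        N.dual (lam t) - N.dual lamStar ≤ ‖lamStar‖ ^ 2 / (2 * γ * t)) ∧
      (∃ lamLim : N.Price, N.IsDualOptimal lamLim ∧ Tendsto lam atTop (𝓝 lamLim)) ∧
      (∃ fStar : N.Flow, N.IsPrimalOptimal fStar ∧
        (∀ g : N.Flow, N.IsPrimalOptimal g → g = fStar) ∧ Tendsto f atTop (𝓝 fStar)) := by
  refine ⟨fun ν => ?_, fun lam f hrun => ?_⟩
  · obtain ⟨g, hg⟩ := N.exists_mem_bestResponse ν
    exact ⟨g, hg, fun g' hg' => PaymentNetwork.eq_of_mem_bestResponse hη hweight hg' hg⟩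
  obtain ⟨fStar, hfStar⟩ := N.exists_isPrimalOptimal
  obtain ⟨μ, hμ, hμval, hμbest⟩ := hfStar.exists_isDualOptimal hη hweight
  have hsub := fun t ν => PaymentNetwork.dual_sub_inner_le_dual (hrun.flow t) ν
  have hdec := hrun.dual_succ_le hη hweight hγ hstep.le
  refine ⟨fun lamStar _ t ht => ?_, ?_, fStar, hfStar, fun g hg => ?_, ?_⟩
  · have := value_sub_le_of_sufficient_decrease hγ hrun.step hsub hdec lamStar ht
    rwa [hrun.init, zero_sub, norm_neg] at this
  · exact exists_tendsto_minimizer_of_sufficient_decrease hγ hrun.step hsub hdec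
      PaymentNetwork.lowerSemicontinuous_dual hμ
  · -- Primal optima have the same Lagrangian value at the multiplier `μ` of `fStar`, so each of
    -- them is a best response to `μ`.
    refine PaymentNetwork.eq_of_mem_bestResponse hη hweight (lam := μ) ⟨hg.1.1, fun g' hg' => ?_⟩
      hμbest
    refine (hμbest.2 g' hg').trans ?_
    rw [PaymentNetwork.lagrangian_eq_objective_of_mem_feasible hg.1,
      PaymentNetwork.lagrangian_eq_objective_of_mem_feasible hfStar.1]
    exact hg.2 fStar hfStar.1
  · refine hrun.tendsto_flow hη hweight hfStar ?_
    rw [← hμval]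
    exact tendsto_value_of_sufficient_decrease hγ hrun.step hsub hdec hμ
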